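/- **Setting.** Let $T\ge 2$ and let $\mathcal S_1,\dots,\mathcal S_T$ be discrete state spaces, $\mathcal S_{1:t}=\mathcal S_1\times\dots\times\mathcal S_t$. Fix a prompt $s_0$. Let $\pi_{\rm ref}(\cdot\mid s_0,s_{1:t})$ be an autoregressive base model (a probability mass function on $\mathcal S_{t+1}$ for each prefix $s_{1:t}$), and let $\hat V(s_0,s_{1:t})>0$, $0\le t\le T$, be a reward model on prefixes ($s_{1:0}=\varnothing$; the usual normalization is $\hat V(s_0,\varnothing)=1$). The target is $\tilde\pi_T(s_{1:T})\propto \pi_{\rm ref}(s_{1:T}\mid s_0)\,\hat V(s_0,s_{1:T})$. Assume that for some $L>0$ and some $\varepsilon_g$: 1. (ratio bound) for all $1\le t\le T$ and all $s_{1:t}$, $$\max\Big\{\tfrac{\hat V(s_0,s_{1:t-1})}{\hat V(s_0,s_{1:t})},\tfrac{\hat V(s_0,s_{1:t})}{\hat V(s_0,s_{1:t-1})}\Big\}\le L;$$ 2. (global Bellman error bound) for all $1\le t\le T$ and all $s_{1:t}$, $$\max\Big\{\tfrac{\hat V(s_0,s_{1:t})}{\mathbb E_{\pi_{\rm ref}}[\hat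 V(s_0,s_{1:T})\mid s_{1:t}]},\tfrac{\mathbb E_{\pi_{\rm ref}}[\hat V(s_0,s_{1:T})\mid s_{1:t}]}{\hat V(s_0,s_{1:t})}\Big\}\le 1+\varepsilon_g .$$ **Naive-proposal SMC.** Let $M_{t}$ be the kernel that appends $s_{t}\sim\pi_{\rm ref}(\cdot\mid s_0,s_{1:t-1})$ to $s_{1:t-1}$, and $G_t(s_{1:t})=\hat V(s_0,s_{1:t})/\hat V(s_0,s_{1:t-1})$. The Feynman–Kac flow is $\eta_1=\pi_{\rm ref}(\cdot\mid s_0)$, $\eta_{t+1}=\Phi_{t+1}(\eta_t)$, where $\Phi_{t+1}(\eta)$ reweights $\eta$ by $G_t$, normalizes, and applies $M_{t+1}$, with $M_{T+1}=\mathrm{Id}$. An SMC sampler with $N\ge 1$ particles draws $X_1^1,\dots,X_1^N$ i.i.d. from $\eta_1$ and then, given the particles at time $t$ with empirical measure $\eta_t^N$, draws $X_{t+1}^i\sim K_{t+1,\eta_t^N}(X_t^i,\cdot)$ independently, $t=1,\dots,T$, where the $K_{t+1,\eta}$ are any Markov kernels with $\eta K_{t+1,\eta}=\Phi_{t+1}(\eta)$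 for all $\eta$. Its output law is $\bar\eta^N_{T+1}=\mathbb E[\eta^N_{T+1}]$. The naive-proposal SMC algorithm uses $K_{t+1,\eta}(x,\cdot)=\Phi_{t+1}(\eta)$: in each step it weights the particles by $G_t$, resamples $N$ i.i.d. ancestors from the normalized weights and extends them by $\pi_{\rm ref}$; after a terminal weighting and resampling step it outputs a uniformly chosen particle. Its running time is counted in elementary operations: base-model draws, reward-model evaluations, arithmetic operations, extending or copying a particle, and random index draws, where resampling $N$ indices from $N$ weights costs $O(N)$. **Claim.** $\eta_{T+1}=\tilde\pi_T$, and for every $\delta_{\rm TV}\in(0,1)$ the following hold. * *Particles.* If $$N\ \ge\ \frac{L^6\,T\,(1+\varepsilon_g)^6}{2\,\delta_{\rm TV}},$$ then $\|\bar\eta^N_{T+1}-\tilde\pi_T\|_{\rm TV}\le\delta_{\rm TV}$ for every such SMC sampler, in particular for the naive-proposal SMC algorithm. * *Time.* There is a number of particles $N$ satisfying this bound for which the naive-proposal SMC algorithm, with total variation error at most $\delta_{\rm TV}$, always runs in time at most $$C\,\frac{L^6(1+\varepsilon_g)^6\,T^2}{\delta_{\rm TV}},$$ where $C$ is a universal constant.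 -/

import Mathlib

open scoped NNReal ENNReal

noncomputable section

namespace SMC

universe u v

/-! ## Discrete probability -/

/-- The probability mass function proportional to `f`. The second argument is a fallback, used only
if `f` has total mass `0` or `∞`. -/
def normalizeOr {α : Type u} (f : α → ℝ≥0∞) (fallback : PMF α) : PMF α :=
  open Classical in
  if h : (∑' a, f a) ≠ 0 ∧ (∑' a, f a) ≠ ∞ then PMF.normalize f h.1 h.2 else fallback

/-- The law `μ` reweighted by the nonnegative function `g`, i.e. the law proportional to `μ * g`. -/
def reweight {α : Type u} (μ : PMF α) (g : α → ℝ≥0) : PMF α :=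
  normalizeOr (fun a => μ a * (g a : ℝ≥0∞)) μ

/-- Expectation of a real function. -/
def expect {α : Type u} (μ : PMF α) (f : α → ℝ) : ℝ :=
  ∑' a, (μ a).toReal * f a

/-- Total variation distance: the supremum over all events of the difference of the
probabilities. -/
def tvDist {α : Type u} (μ ν : PMF α) : ℝ :=
  ⨆ A : Set α, |(μ.toOuterMeasure A).toReal - (ν.toOuterMeasure A).toReal|

/-- The law of independent random variables `X 0, …, X (N - 1)` with `X i` of law `p i`. -/
def indep {α : Type u} : {N : ℕ} → (Fin N → PMF α) → PMF (Fin N → α)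
  | 0, _ => PMF.pure Fin.elim0
  | _ + 1, p => (p 0).bind fun a => (indep fun i => p i.succ).map fun x => Fin.cons a x

/-- The empirical measure `(1 / N) ∑ i, δ_{x i}` of a nonempty particle configuration. -/
def empirical {α : Type u} {N : ℕ} [NeZero N] (x : Fin N → α) : PMF α :=
  (PMF.uniformOfFintype (Fin N)).map x

/-- The categorical law on `Fin N` with probabilities proportional to the weights `w`
(uniform if all weights vanish). -/
def categorical {N : ℕ} [NeZero N] (w : Fin N → ℝ≥0) : PMF (Fin N) :=
  normalizeOr (fun i => (w i : ℝ≥0∞)) (PMF.uniformOfFintype (Fin N))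

/-! ## Reasoning trajectories, base model and reward model

`S 0` is the prompt space and `S t`, `t ≥ 1`, is the state space (tokens or sentences) of the
`t`-th reasoning step. In this section the prompt is fixed: `π t x` is the law of the next state
`s_{t+1}` given the prefix `x = s_{1:t}`, and `V t x` is the value `V(s_0, s_{1:t})` of the
reward model. -/

/-- The space `S_{1:t}` of prefixes of length `t`. -/
def Prefix (S : ℕ → Type u) : ℕ → Type u
  | 0 => PUnit
  | t + 1 => Prefix S t × S (t + 1)

section Model

variable {S : ℕ → Type u}

/-- The empty prefix. -/
def Prefix.nil : Prefix S 0 := PUnit.unit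

/-- Append a state to a prefix. -/
def Prefix.snoc {t : ℕ} (x : Prefix S t) (s : S (t + 1)) : Prefix S (t + 1) := (x, s)

/-- Drop the last state: `s_{1:t+1} ↦ s_{1:t}`. -/
def Prefix.init {t : ℕ} (x : Prefix S (t + 1)) : Prefix S t := Prod.fst x

/-- The naive proposal kernel `M_{t+1}` from `S_{1:t}` to `S_{1:t+1}`: keep the prefix and append a
state drawn from the base model. -/
def naiveKernel (π : ∀ t, Prefix S t → PMF (S (t + 1))) (t : ℕ) (x : Prefix S t) :
    PMF (Prefix S (t + 1)) :=
  (π t x).map x.snoc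

/-- The law of the trajectory `s_{1:T}` under the base model, given its prefix `s_{1:t} = x`. -/
def rollout (π : ∀ t, Prefix S t → PMF (S (t + 1))) {t T : ℕ} (h : t ≤ T) (x : Prefix S t) :
    PMF (Prefix S T) :=
  Nat.leRecOn (C := fun k => PMF (Prefix S k)) h (fun {k} μ => μ.bind (naiveKernel π k))
    (PMF.pure x)

/-- The reward-tilted target law on trajectories, proportional to `π(s_{1:T}) V(s_{1:T})`. -/
def target (π : ∀ t, Prefix S t → PMF (S (t + 1))) (V : ∀ t, Prefix S t → ℝ≥0) (T : ℕ) :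
    PMF (Prefix S T) :=
  reweight (rollout π (Nat.zero_le T) Prefix.nil) (V T)

/-- Reward model ratio bound with constant `L`. -/
def RatioBound (V : ∀ t, Prefix S t → ℝ≥0) (T : ℕ) (L : ℝ) : Prop :=
  ∀ t < T, ∀ x : Prefix S (t + 1),
    max ((V t x.init : ℝ) / V (t + 1) x) ((V (t + 1) x : ℝ) / V t x.init) ≤ L

/-- Global Bellman error bound with constant `ε`. -/
def GlobalBellmanBound (π : ∀ t, Prefix S t → PMF (S (t + 1))) (V : ∀ t, Prefix S t → ℝ≥0)
    (T : ℕ) (ε : ℝ) : Prop :=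
  ∀ t, 1 ≤ t → ∀ (h : t ≤ T) (x : Prefix S t),
    max ((V t x : ℝ) / expect (rollout π h x) (fun y => (V T y : ℝ)))
      (expect (rollout π h x) (fun y => (V T y : ℝ)) / (V t x : ℝ)) ≤ 1 + ε

/-! ## The Feynman–Kac flow and the SMC sampler (naive proposal) -/

/-- The potentials (incremental weights) of the naive proposal:
`G_t(s_{1:t}) = V(s_0, s_{1:t}) / V(s_0, s_{1:t-1})` for `t ≥ 1`, and `G_0 = 1`. -/
def potential (V : ∀ t, Prefix S t → ℝ≥0) : ∀ t, Prefix S t → ℝ≥0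
  | 0, _ => 1
  | t + 1, x => V (t + 1) x / V t x.init

/-- The normalized Feynman–Kac map `Φ_{t+1}`: reweight by `G_t`, then propagate by `M_{t+1}`. -/
def fkMap (π : ∀ t, Prefix S t → PMF (S (t + 1))) (V : ∀ t, Prefix S t → ℝ≥0) (t : ℕ)
    (η : PMF (Prefix S t)) : PMF (Prefix S (t + 1)) :=
  (reweight η (potential V t)).bind (naiveKernel π t)

/-- The Feynman–Kac flow `η_t`, started from the empty prefix, so `η_1 = π(· | s_0)`. -/
def fkFlow (π : ∀ t, Prefix S t → PMF (S (t + 1))) (V : ∀ t, Prefix S t → ℝ≥0) :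
    ∀ t, PMF (Prefix S t)
  | 0 => PMF.pure Prefix.nil
  | t + 1 => fkMap π V t (fkFlow π V t)

/-- The terminal Feynman–Kac map `Φ_{T+1}`: reweight by `G_T`, then apply `M_{T+1} = Id`. -/
def fkTerminalMap (V : ∀ t, Prefix S t → ℝ≥0) (T : ℕ) (η : PMF (Prefix S T)) :
    PMF (Prefix S T) :=
  reweight η (potential V T)

/-- The terminal law `η_{T+1}` of the Feynman–Kac flow. -/
def fkTerminal (π : ∀ t, Prefix S t → PMF (S (t + 1))) (V : ∀ t, Prefix S t → ℝ≥0) (T : ℕ) :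
    PMF (Prefix S T) :=
  fkTerminalMap V T (fkFlow π V T)

/-- `K` (for the steps `1, …, T`) and `K'` (for the terminal step `T + 1`) are McKean kernels of the
Feynman–Kac flow: `η K_{p+1,η} = Φ_{p+1}(η)` for every law `η`. -/
def IsMcKean (π : ∀ t, Prefix S t → PMF (S (t + 1))) (V : ∀ t, Prefix S t → ℝ≥0) (T : ℕ)
    (K : ∀ t, PMF (Prefix S t) → Prefix S t → PMF (Prefix S (t + 1)))
    (K' : PMF (Prefix S T) → Prefix S T → PMF (Prefix S T)) : Prop :=
  (∀ t < T, ∀ η, η.bind (K t η) = fkMap π V t η) ∧ ∀ η, η.bind (K' η) = fkTerminalMap V T η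

/-- The joint law of the `N` particles at time `t`. Given the particles at time `t`, with empirical
measure `η`, the next ones are drawn independently, the `i`-th one from `K_{t+1,η}(X_t^i, ·)`. All
particles start from the empty prefix at time `0`, so McKean kernels yield `N` independent samples
of `η_1` at time `1`. -/
def particleLaw (K : ∀ t, PMF (Prefix S t) → Prefix S t → PMF (Prefix S (t + 1)))
    (N : ℕ) [NeZero N] : ∀ t, PMF (Fin N → Prefix S t)
  | 0 => PMF.pure fun _ => Prefix.nil
  | t + 1 => (particleLaw K N t).bind fun x => indep fun i => K t (empirical x) (x i)

/-- The output law `E[η_{T+1}^N]` of the SMC sampler: the mean of the empirical measure of the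
particles after the terminal step. -/
def outputLaw {T : ℕ} (K : ∀ t, PMF (Prefix S t) → Prefix S t → PMF (Prefix S (t + 1)))
    (K' : PMF (Prefix S T) → Prefix S T → PMF (Prefix S T)) (N : ℕ) [NeZero N] :
    PMF (Prefix S T) :=
  ((particleLaw K N T).bind fun x => indep fun i => K' (empirical x) (x i)).bind empirical

end Model

/-! ## Randomized computations with a step count -/

/-- A randomized computation: the joint law of its result and of the number of elementary
operations that it performs. -/
def Timed (α : Type u) : Type u := PMF (α × ℕ)

/-- Return a value at no cost. -/
def Timed.ret {α : Type u} (a : α) : Timed α := PMF.pure (a, 0)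

/-- Run `x`, then run `f` on its result with fresh randomness. The step counts add up. -/
def Timed.bind {α : Type u} {β : Type v} (x : Timed α) (f : α → Timed β) : Timed β :=
  PMF.bind x fun p => PMF.map (fun q : β × ℕ => (q.1, p.2 + q.2)) (f p.1)

/-- A deterministic computation of `a` with `k` elementary operations. -/
def Timed.calc {α : Type u} (k : ℕ) (a : α) : Timed α := PMF.pure (a, k)

/-- One random draw from `p`, as one elementary operation. -/
def Timed.draw {α : Type u} (p : PMF α) : Timed α := PMF.map (fun a => (a, 1)) p

/-- A loop that runs `c 0, …, c (N - 1)` one after the other and collects the results. -/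
def Timed.forEach {α : Type u} : {N : ℕ} → (Fin N → Timed α) → Timed (Fin N → α)
  | 0, _ => Timed.ret Fin.elim0
  | _ + 1, c => (c 0).bind fun a => (Timed.forEach fun i => c i.succ).bind fun x =>
      Timed.ret (Fin.cons a x)

/-- The law of the result. -/
def Timed.output {α : Type u} (x : Timed α) : PMF α := PMF.map Prod.fst x

/-- No run performs more than `B` elementary operations. -/
def Timed.RunsWithin {α : Type u} (x : Timed α) (B : ℝ) : Prop :=
  ∀ p ∈ PMF.support x, (p.2 : ℝ) ≤ B

/-! ## The naive-proposal SMC algorithm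

Elementary operations, at unit cost: a draw of the next state from the base model, an evaluation of
the reward model, an arithmetic operation, appending a state to a prefix or copying a reference to a
prefix, a uniform draw from the particle indices, and a draw from a categorical law whose sampling
table has been set up. -/

section Algorithm

variable {S : ℕ → Type u}

/-- The incremental weight of a particle: two evaluations of the reward model and a division. (At
time `0` there is nothing to weight.) -/
def weightStep (V : ∀ t, Prefix S t → ℝ≥0) : ∀ t, Prefix S t → Timed ℝ≥0
  | 0, _ => Timed.ret 1
  | t + 1, x => (Timed.calc 1 (V (t + 1) x)).bind fun a =>
      (Timed.calc 1 (V t x.init)).bind fun b => Timed.calc 1 (a / b)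

/-- Draw `N` independent ancestor indices from the categorical law of the weights: `N` operations
each to sum up the weights, to normalize them and to set up the sampling table, then one operation
for each draw. -/
def resample {N : ℕ} [NeZero N] (w : Fin N → ℝ≥0) : Timed (Fin N → Fin N) :=
  (Timed.calc (3 * N) (categorical w)).bind fun p => Timed.forEach fun _ => Timed.draw p

/-- Draw the next state from the base model and append it. -/
def extend (π : ∀ t, Prefix S t → PMF (S (t + 1))) (t : ℕ) (x : Prefix S t) :
    Timed (Prefix S (t + 1)) :=
  (Timed.draw (π t x)).bind fun s => Timed.calc 1 (x.snoc s)

/-- One round: weight and resample the particles (except at time `0`), then propagate them. -/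
def smcRound (π : ∀ t, Prefix S t → PMF (S (t + 1))) (V : ∀ t, Prefix S t → ℝ≥0) {N : ℕ}
    [NeZero N] : ∀ t, (Fin N → Prefix S t) → Timed (Fin N → Prefix S (t + 1))
  | 0, x => Timed.forEach fun i => extend π 0 (x i)
  | t + 1, x => (Timed.forEach fun j => weightStep V (t + 1) (x j)).bind fun w =>
      (resample w).bind fun A => Timed.forEach fun i => extend π (t + 1) (x (A i))

/-- The particles after `t` rounds. -/
def smcRounds (π : ∀ t, Prefix S t → PMF (S (t + 1))) (V : ∀ t, Prefix S t → ℝ≥0) (N : ℕ)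
    [NeZero N] : ∀ t, Timed (Fin N → Prefix S t)
  | 0 => Timed.ret fun _ => Prefix.nil
  | t + 1 => (smcRounds π V N t).bind (smcRound π V t)

/-- The naive-proposal SMC algorithm: `T` rounds, the terminal weighting and resampling step, and
the output of a uniformly chosen particle. -/
def naiveSMC (π : ∀ t, Prefix S t → PMF (S (t + 1))) (V : ∀ t, Prefix S t → ℝ≥0) (T N : ℕ)
    [NeZero N] : Timed (Prefix S T) :=
  (smcRounds π V N T).bind fun x =>
    (Timed.forEach fun j => weightStep V T (x j)).bind fun w =>
      (resample w).bind fun A =>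
        (Timed.forEach fun i => Timed.calc 1 (x (A i))).bind fun y =>
          (Timed.draw (PMF.uniformOfFintype (Fin N))).bind fun I => Timed.ret (y I)

end Algorithm

end SMC

end

namespace SMC

universe u v

/-! ## Expectations of bounded functions -/

/-! Write `M = L * (1 + ε)` and fix a test function `f` with values in `[0, 1]`; indicators of
events are enough for total variation. The incremental weights telescope, so the unnormalized
semigroup from time `t` is explicit: `semigroup` is a base-model expectation of `V_T * f` divided by
the reward one step before `t`. Its normalized version `terminalMean` is invariant under the
Feynman–Kac map (`terminalMean_fkMap`), which already identifies the terminal law with the target.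

For the particles, the mean of `terminalMean` at the empirical measure equals the target integral at
time `0`, where all particles are the empty prefix, and the integral under the output law at time
`T`, since the terminal step is unbiased given the particles. It remains to bound the change in each
of the `T` steps in between. Conditionally on the past, this change is the bias of a ratio of sums
of independent variables whose average law is the Feynman–Kac image of the empirical measure,
whatever the McKean kernel. The denominators lie in `[1/M, M]` by the two assumptions
(`semigroup_one_mem_Icc`), and a second-moment argument (`abs_expect_indep_ratio_sub_le`) bounds the
bias by `M ^ 2 / (2 * N)`.

The total error is thus at most `T * M ^ 2 / (2 * N)`, and `M ≥ 1` makes the stated `N`, with its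
sixth power, more than sufficient. The time bound counts at most `9 * N` operations per round. -/

/-- A bounded real function. -/
def IsBdd {α : Type u} (f : α → ℝ) : Prop := ∃ C, ∀ a, |f a| ≤ C

section Bounded

variable {α : Type u} {f g : α → ℝ}

theorem IsBdd.const (c : ℝ) : IsBdd fun _ : α => c := ⟨|c|, fun _ => le_rfl⟩

theorem IsBdd.of_mem_Icc {a b : ℝ} (h : ∀ x, a ≤ f x ∧ f x ≤ b) : IsBdd f :=
  ⟨max |a| |b|, fun x => abs_le_max_abs_abs (h x).1 (h x).2⟩

theorem IsBdd.add (hf : IsBdd f) (hg : IsBdd g) : IsBdd fun a => f a + g a := by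
  obtain ⟨C, hC⟩ := hf
  obtain ⟨D, hD⟩ := hg
  exact ⟨C + D, fun a => (abs_add_le _ _).trans (add_le_add (hC a) (hD a))⟩

theorem IsBdd.mul (hf : IsBdd f) (hg : IsBdd g) : IsBdd fun a => f a * g a := by
  obtain ⟨C, hC⟩ := hf
  obtain ⟨D, hD⟩ := hg
  refine ⟨C * D, fun a => ?_⟩
  rw [abs_mul]
  exact mul_le_mul (hC a) (hD a) (abs_nonneg _) ((abs_nonneg _).trans (hC a))

theorem IsBdd.sub (hf : IsBdd f) (hg : IsBdd g) : IsBdd fun a => f a - g a := by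
  simpa [sub_eq_add_neg] using hf.add ((IsBdd.const (-1)).mul hg)

theorem IsBdd.sq (hf : IsBdd f) : IsBdd fun a => f a ^ 2 := by
  simpa [pow_two] using hf.mul hf

theorem IsBdd.sum {ι : Type v} (s : Finset ι) {F : ι → α → ℝ} (h : ∀ i, IsBdd (F i)) :
    IsBdd fun a => ∑ i ∈ s, F i a := by
  choose C hC using h
  exact ⟨∑ i ∈ s, C i, fun a =>
    (Finset.abs_sum_le_sum_abs _ _).trans (Finset.sum_le_sum fun i _ => hC i a)⟩

theorem IsBdd.comp {β : Type v} (hf : IsBdd f) (k : β → α) : IsBdd fun b => f (k b) := by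
  obtain ⟨C, hC⟩ := hf
  exact ⟨C, fun b => hC _⟩

end Bounded

section Expect

variable {α : Type u} {β : Type v} (μ : PMF α) {f g : α → ℝ}

theorem summable_toReal : Summable fun a => (μ a).toReal :=
  ENNReal.summable_toReal μ.tsum_coe_ne_top

theorem summable_expect (hf : IsBdd f) : Summable fun a => (μ a).toReal * f a := by
  obtain ⟨C, hC⟩ := hf
  refine Summable.of_norm_bounded ((summable_toReal μ).mul_right C) fun a => ?_
  rw [norm_mul, Real.norm_of_nonneg ENNReal.toReal_nonneg]
  exact mul_le_mul_of_nonneg_left (hC a) ENNReal.toReal_nonneg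

theorem expect_const (c : ℝ) : expect μ (fun _ => c) = c := by
  unfold expect
  rw [tsum_mul_right, ← ENNReal.tsum_toReal_eq fun a => μ.apply_ne_top a, μ.tsum_coe]
  simp

theorem expect_add (hf : IsBdd f) (hg : IsBdd g) :
    expect μ (fun a => f a + g a) = expect μ f + expect μ g := by
  unfold expect
  rw [← (summable_expect μ hf).tsum_add (summable_expect μ hg)]
  simp only [mul_add]

theorem expect_mul_left (c : ℝ) (f : α → ℝ) :
    expect μ (fun a => c * f a) = c * expect μ f := by
  unfold expect
  rw [← tsum_mul_left]
  exact tsum_congr fun a => by ring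

theorem expect_mul_right (c : ℝ) (f : α → ℝ) :
    expect μ (fun a => f a * c) = expect μ f * c := by
  simp only [mul_comm _ c, expect_mul_left]

theorem expect_sub (hf : IsBdd f) (hg : IsBdd g) :
    expect μ (fun a => f a - g a) = expect μ f - expect μ g := by
  have := expect_add μ hf ((IsBdd.const (-1)).mul hg)
  rw [expect_mul_left] at this
  simpa [sub_eq_add_neg] using this

theorem expect_mono (hf : IsBdd f) (hg : IsBdd g) (h : ∀ a, f a ≤ g a) :
    expect μ f ≤ expect μ g :=
  (summable_expect μ hf).tsum_le_tsum
    (fun a => mul_le_mul_of_nonneg_left (h a) ENNReal.toReal_nonneg) (summable_expect μ hg)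

theorem expect_mem_Icc {a b : ℝ} (h : ∀ x, a ≤ f x ∧ f x ≤ b) :
    a ≤ expect μ f ∧ expect μ f ≤ b := by
  have hf : IsBdd f := .of_mem_Icc h
  constructor
  · simpa [expect_const] using expect_mono μ (.const a) hf fun x => (h x).1
  · simpa [expect_const] using expect_mono μ hf (.const b) fun x => (h x).2

theorem abs_expect_le {C : ℝ} (h : ∀ a, |f a| ≤ C) : |expect μ f| ≤ C :=
  abs_le.2 (expect_mem_Icc μ fun a => abs_le.1 (h a))

theorem IsBdd.expect {f : β → ℝ} (hf : IsBdd f) (k : α → PMF β) :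
    IsBdd fun a => SMC.expect (k a) f := by
  obtain ⟨C, hC⟩ := hf
  exact ⟨C, fun a => abs_expect_le _ hC⟩

theorem expect_pure (a : α) (f : α → ℝ) : expect (PMF.pure a) f = f a := by
  unfold expect
  rw [tsum_eq_single a]
  · simp
  · intro b hb
    simp [PMF.pure_apply, hb]

/-- Fubini: the joint masses `μ a * k a b` are summable, so boundedness of `f` gives the absolute
summability needed to exchange the sums. -/
theorem expect_bind (k : α → PMF β) {f : β → ℝ} (hf : IsBdd f) :
    expect (μ.bind k) f = expect μ fun a => expect (k a) f := by
  have hs : Summable fun p : α × β => (μ p.1).toReal * (k p.1 p.2).toReal := by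
    have : (∑' p : α × β, μ p.1 * k p.1 p.2) ≠ ∞ := by
      rw [ENNReal.tsum_prod' (f := fun p : α × β => μ p.1 * k p.1 p.2)]
      simp [ENNReal.tsum_mul_left, PMF.tsum_coe]
    simpa [ENNReal.toReal_mul] using ENNReal.summable_toReal this
  obtain ⟨C, hC⟩ := hf
  have hs' : Summable fun p : α × β => (μ p.1).toReal * (k p.1 p.2).toReal * f p.2 := by
    refine Summable.of_norm_bounded (hs.mul_right C) fun p => ?_
    rw [norm_mul, Real.norm_of_nonneg (by positivity)]
    exact mul_le_mul_of_nonneg_left (hC _) (by positivity)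
  unfold expect
  calc ∑' b, ((μ.bind k) b).toReal * f b
      = ∑' b, ∑' a, (μ a).toReal * (k a b).toReal * f b := by
        refine tsum_congr fun b => ?_
        rw [PMF.bind_apply, ENNReal.tsum_toReal_eq fun a =>
          ENNReal.mul_ne_top (μ.apply_ne_top a) ((k a).apply_ne_top b), ← tsum_mul_right]
        simp only [ENNReal.toReal_mul]
    _ = ∑' a, ∑' b, (μ a).toReal * (k a b).toReal * f b := by
        rw [Summable.tsum_comm (f := fun a b => (μ a).toReal * (k a b).toReal * f b) hs']
    _ = _ := by simp only [mul_assoc, tsum_mul_left]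

theorem expect_map (k : α → β) {f : β → ℝ} (hf : IsBdd f) :
    expect (μ.map k) f = expect μ fun a => f (k a) := by
  rw [← PMF.bind_pure_comp, expect_bind _ _ hf]
  simp only [Function.comp_apply, expect_pure]

theorem pmf_ext_expect {μ ν : PMF α}
    (h : ∀ f : α → ℝ, (∀ a, 0 ≤ f a ∧ f a ≤ 1) → expect μ f = expect ν f) : μ = ν := by
  classical
  have key (ρ : PMF α) (a : α) : expect ρ (fun b => if b = a then 1 else 0) = (ρ a).toReal := by
    unfold expect
    rw [tsum_eq_single a]
    · simp
    · intro b hb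
      simp [hb]
  ext a
  rw [← ENNReal.toReal_eq_toReal_iff' (μ.apply_ne_top a) (ν.apply_ne_top a), ← key μ, ← key ν]
  exact h _ fun b => by split_ifs <;> norm_num

theorem toOuterMeasure_toReal_eq_expect (A : Set α) :
    (μ.toOuterMeasure A).toReal = expect μ (A.indicator 1) := by
  rw [PMF.toOuterMeasure_apply, ENNReal.tsum_toReal_eq]
  · refine tsum_congr fun a => ?_
    by_cases h : a ∈ A <;> simp [h]
  · intro a
    by_cases h : a ∈ A <;> simp [h, μ.apply_ne_top]

theorem tvDist_le {μ ν : PMF α} {δ : ℝ} (hδ : 0 ≤ δ)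
    (h : ∀ f : α → ℝ, (∀ a, 0 ≤ f a ∧ f a ≤ 1) → |expect μ f - expect ν f| ≤ δ) :
    tvDist μ ν ≤ δ := by
  refine Real.iSup_le (fun A => ?_) hδ
  rw [toOuterMeasure_toReal_eq_expect, toOuterMeasure_toReal_eq_expect]
  refine h _ fun a => ?_
  by_cases h : a ∈ A <;> simp [h]

theorem expect_normalizeOr {w : α → ℝ≥0∞} (hw : ∑' a, w a ≠ 0) (hw' : ∑' a, w a ≠ ∞)
    (ν : PMF α) (f : α → ℝ) :
    expect (normalizeOr w ν) f = (∑' a, (w a).toReal * f a) / ∑' a, (w a).toReal := by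
  have : normalizeOr w ν = PMF.normalize w hw hw' := dif_pos ⟨hw, hw'⟩
  rw [this, ← ENNReal.tsum_toReal_eq fun a => ENNReal.ne_top_of_tsum_ne_top hw' a]
  unfold expect
  rw [div_eq_mul_inv, ← tsum_mul_right]
  refine tsum_congr fun a => ?_
  rw [PMF.normalize_apply, ENNReal.toReal_mul, ENNReal.toReal_inv]
  ring

theorem expect_reweight {w : α → ℝ≥0} (hw : ∀ a, 0 < w a) (hb : IsBdd fun a => (w a : ℝ))
    (f : α → ℝ) :
    expect (reweight μ w) f
      = expect μ (fun a => (w a : ℝ) * f a) / expect μ fun a => (w a : ℝ) := by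
  have h0 : ∑' a, μ a * (w a : ℝ≥0∞) ≠ 0 := by
    obtain ⟨a, ha⟩ := μ.support_nonempty
    rw [Ne, ENNReal.tsum_eq_zero, not_forall]
    exact ⟨a, mul_ne_zero ((μ.mem_support_iff a).1 ha) (by simpa using (hw a).ne')⟩
  have h1 : ∑' a, μ a * (w a : ℝ≥0∞) ≠ ∞ := by
    obtain ⟨C, hC⟩ := hb
    have hle (a : α) : μ a * (w a : ℝ≥0∞) ≤ μ a * ENNReal.ofReal C := by
      gcongr
      rw [ENNReal.le_ofReal_iff_toReal_le ENNReal.coe_ne_top ((abs_nonneg _).trans (hC a))]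
      simpa using hC a
    refine ne_top_of_le_ne_top ?_ (ENNReal.tsum_le_tsum hle)
    rw [ENNReal.tsum_mul_right, μ.tsum_coe, one_mul]
    exact ENNReal.ofReal_ne_top
  rw [reweight, expect_normalizeOr h0 h1]
  simp [expect, ENNReal.toReal_mul, mul_assoc]

end Expect

/-! ## Empirical measures and independent samples -/

section Samples

variable {α : Type u} {β : Type v} {N : ℕ}

theorem expect_empirical [NeZero N] (x : Fin N → α) {f : α → ℝ} (hf : IsBdd f) :
    expect (empirical x) f = (∑ i, f (x i)) / N := by
  rw [empirical, expect_map _ _ hf, expect, tsum_fintype, Finset.sum_div]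
  refine Finset.sum_congr rfl fun i _ => ?_
  simp [div_eq_inv_mul]

theorem expect_categorical [NeZero N] {w : Fin N → ℝ≥0} (hw : ∀ i, 0 < w i) (f : Fin N → ℝ) :
    expect (categorical w) f = (∑ i, (w i : ℝ) * f i) / ∑ i, (w i : ℝ) := by
  rw [categorical, expect_normalizeOr]
  · simp [tsum_fintype]
  · rw [Ne, ENNReal.tsum_eq_zero, not_forall]
    exact ⟨0, by simpa using (hw 0).ne'⟩
  · rw [tsum_fintype]
    simp

theorem indep_succ (p : Fin (N + 1) → PMF α) :
    indep p = (p 0).bind fun a => (indep fun i => p i.succ).map fun x => Fin.cons a x := rfl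

theorem expect_indep_succ (p : Fin (N + 1) → PMF α) {F : (Fin (N + 1) → α) → ℝ} (hF : IsBdd F) :
    expect (indep p) F
      = expect (p 0) fun a => expect (indep fun i => p i.succ) fun x => F (Fin.cons a x) := by
  rw [indep_succ, expect_bind _ _ hF]
  simp only [expect_map _ _ hF]

theorem IsBdd.sum_eval {f : α → ℝ} (hf : IsBdd f) : IsBdd fun x : Fin N → α => ∑ i, f (x i) :=
  .sum _ fun i => hf.comp fun x : Fin N → α => x i

theorem expect_indep_sum : ∀ {N : ℕ} (p : Fin N → PMF α) {f : α → ℝ}, IsBdd f →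
    expect (indep p) (fun x => ∑ i, f (x i)) = ∑ i, expect (p i) f
  | 0, p, f, hf => by simp [expect_const]
  | N + 1, p, f, hf => by
    rw [expect_indep_succ _ hf.sum_eval]
    simp only [Fin.sum_univ_succ, Fin.cons_zero, Fin.cons_succ]
    simp only [expect_add _ (.const _) hf.sum_eval, expect_const, expect_indep_sum _ hf,
      expect_add _ hf (.const _)]

/-- The second moment of a shifted sum of independent random variables is at most the sum of their
second moments plus the square of the mean. -/
theorem expect_indep_sum_sq_le : ∀ {N : ℕ} (p : Fin N → PMF α) {f : α → ℝ}, IsBdd f → ∀ c : ℝ,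
    expect (indep p) (fun x => (∑ i, f (x i) + c) ^ 2)
      ≤ ∑ i, expect (p i) (fun a => f a ^ 2) + (∑ i, expect (p i) f + c) ^ 2
  | 0, p, f, hf, c => by simp [expect_const]
  | N + 1, p, f, hf, c => by
    rw [expect_indep_succ _ (hf.sum_eval.add (.const _)).sq]
    simp only [Fin.sum_univ_succ, Fin.cons_zero, Fin.cons_succ]
    set s := ∑ i : Fin N, expect (p i.succ) (fun a => f a ^ 2)
    set m := ∑ i : Fin N, expect (p i.succ) f
    -- The value of the first variable is absorbed into the shift, which is why the induction runs
    -- over all `c`.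
    have step (a : α) : expect (indep fun i => p i.succ) (fun x => (f a + ∑ i, f (x i) + c) ^ 2)
        ≤ f a ^ 2 + f a * (2 * (m + c)) + (s + (m + c) ^ 2) := by
      have := expect_indep_sum_sq_le (fun i => p i.succ) hf (f a + c)
      simp only [show ∀ y : ℝ, y + (f a + c) = f a + y + c from fun y => by ring] at this
      nlinarith [this]
    have hbd : IsBdd fun a => expect (indep fun i => p i.succ)
        fun x => (f a + ∑ i, f (x i) + c) ^ 2 := by
      have h : IsBdd fun q : α × (Fin N → α) => (f q.1 + ∑ i, f (q.2 i) + c) ^ 2 :=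
        (((hf.comp Prod.fst).add (hf.sum_eval.comp Prod.snd)).add (.const _)).sq
      obtain ⟨C, hC⟩ := h
      exact ⟨C, fun a => abs_expect_le _ fun x => hC (a, x)⟩
    refine (expect_mono (p 0) hbd ((hf.sq.add (hf.mul (.const _))).add (.const _)) step).trans ?_
    rw [expect_add _ (hf.sq.add (hf.mul (.const _))) (.const _),
      expect_add _ hf.sq (hf.mul (.const _)), expect_mul_right, expect_const]
    -- The two sides differ exactly by the squared mean of the first variable.
    nlinarith [sq_nonneg (expect (p 0) f)]

theorem indep_pure : ∀ {N : ℕ} (x : Fin N → α), indep (fun i => PMF.pure (x i)) = PMF.pure x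
  | 0, x => congrArg PMF.pure (Subsingleton.elim _ _)
  | N + 1, x => by
    rw [indep_succ, indep_pure fun i => x i.succ, PMF.pure_bind, PMF.pure_map]
    exact congrArg PMF.pure (Fin.cons_self_tail x)

/-- Lets "resample all ancestors, then extend all particles" be read as one independent two-stage
draw per particle. The proof commutes the second-stage draw of the first coordinate past the
first-stage draws of the others. -/
theorem indep_bind_indep : ∀ {N : ℕ} (p : Fin N → PMF α) (k : Fin N → α → PMF β),
    ((indep p).bind fun x => indep fun i => k i (x i)) = indep fun i => (p i).bind (k i)
  | 0, p, k => by
    rw [indep, PMF.pure_bind]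
    rfl
  | N + 1, p, k => by
    rw [indep_succ p, indep_succ fun i => (p i).bind (k i), PMF.bind_bind, PMF.bind_bind]
    congr 1
    funext a
    rw [PMF.bind_map]
    simp only [Function.comp_def, indep_succ, Fin.cons_zero, Fin.cons_succ]
    rw [PMF.bind_comm]
    congr 1
    funext b
    rw [← indep_bind_indep (fun i => p i.succ) fun i => k i.succ, PMF.map_bind]

/-- The bias of the self-normalized estimator with weights `h ∈ [lo, hi]`. -/
theorem abs_expect_indep_ratio_sub_le [NeZero N] (p : Fin N → PMF α) (m : PMF α)
    (hm : ∀ f, IsBdd f → ∑ i, expect (p i) f = N * expect m f) {h F : α → ℝ} {lo hi : ℝ}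
    (hlo : 0 < lo) (hh : ∀ a, lo ≤ h a ∧ h a ≤ hi) (hF : ∀ a, 0 ≤ F a ∧ F a ≤ 1) :
    |expect (indep p) (fun x => (∑ i, h (x i) * F (x i)) / ∑ i, h (x i))
        - expect m (fun a => h a * F a) / expect m h| ≤ hi / lo / (2 * N) := by
  have hN : (0 : ℝ) < N := by exact_mod_cast Nat.pos_of_ne_zero (NeZero.ne N)
  have bh : IsBdd h := .of_mem_Icc hh
  have bF : IsBdd F := .of_mem_Icc hF
  have hμ := expect_mem_Icc m hh
  set μ := expect m h
  have hμ0 : 0 < μ := hlo.trans_le hμ.1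
  set c := expect m (fun a => h a * F a) / μ with hc
  have hcμ : expect m (fun a => h a * F a) = c * μ := by rw [hc]; field_simp
  -- Subtracting the limit ratio `c` centres the numerator: `g` has mean zero under `m`, and the
  -- error of the estimator is `A / B` with `A` the sum of `g`.
  set g : α → ℝ := fun a => h a * F a - c * h a with hg
  have bg : IsBdd g := (bh.mul bF).sub ((IsBdd.const c).mul bh)
  have mg : expect m g = 0 := by
    rw [hg, expect_sub _ (bh.mul bF) ((IsBdd.const c).mul bh), expect_mul_left, hcμ, sub_self]
  have mh2 : expect m (fun a => h a ^ 2) ≤ hi * μ := by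
    rw [← expect_mul_left]
    exact expect_mono _ bh.sq ((IsBdd.const hi).mul bh) fun a => by nlinarith [hh a]
  -- Under `m` tilted by `h`, `F` is a `[0, 1]`-valued variable with mean `c`, so its variance is at
  -- most `c * (1 - c) ≤ 1 / 4`; one factor `h` is bounded by `hi`.
  have mg2 : expect m (fun a => g a ^ 2) ≤ hi * μ / 4 := by
    have b1 := ((bh.mul bF).mul (IsBdd.const (1 - 2 * c)))
    have b2 := (IsBdd.const (c ^ 2)).mul bh
    have e1 : expect m (fun a => g a ^ 2)
        ≤ expect m fun a => hi * (h a * F a * (1 - 2 * c) + c ^ 2 * h a) := by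
      refine expect_mono _ bg.sq ((IsBdd.const hi).mul (b1.add b2)) fun a => ?_
      have ha : 0 < h a := hlo.trans_le (hh a).1
      have q1 : g a ^ 2 ≤ hi * (h a * (F a - c) ^ 2) := by
        have : g a ^ 2 = h a * (h a * (F a - c) ^ 2) := by simp only [hg]; ring
        rw [this]
        exact mul_le_mul_of_nonneg_right (hh a).2 (by positivity)
      refine q1.trans (mul_le_mul_of_nonneg_left ?_ (ha.le.trans (hh a).2))
      have : 0 ≤ h a * (F a * (1 - F a)) :=
        mul_nonneg ha.le (mul_nonneg (hF a).1 (by linarith [(hF a).2]))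
      nlinarith
    rw [expect_mul_left, expect_add _ b1 b2, expect_mul_right, expect_mul_left, hcμ] at e1
    have : 0 ≤ hi * μ * (c - 1 / 2) ^ 2 := by
      have : 0 ≤ hi := hlo.le.trans (hμ.1.trans hμ.2)
      positivity
    change _ ≤ hi * (c * μ * (1 - 2 * c) + c ^ 2 * μ) at e1
    nlinarith
  have vg := expect_indep_sum_sq_le p bg 0
  have vh := expect_indep_sum_sq_le p bh (-(N * μ))
  rw [hm _ bg.sq, hm _ bg, mg] at vg
  rw [hm _ bh.sq, hm _ bh] at vh
  change _ ≤ N * expect m (fun a => h a ^ 2) + (N * μ + -(N * μ)) ^ 2 at vh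
  have eg : expect (indep p) (fun x => ∑ i, g (x i)) = 0 := by
    rw [expect_indep_sum _ bg, hm _ bg, mg, mul_zero]
  have hB (x : Fin N → α) : N * lo ≤ ∑ i, h (x i) := by
    have := Finset.sum_le_sum fun i (_ : i ∈ Finset.univ) => (hh (x i)).1
    simpa using this
  have hB0 (x : Fin N → α) : 0 < ∑ i, h (x i) := (by positivity : 0 < N * lo).trans_le (hB x)
  set A : (Fin N → α) → ℝ := fun x => ∑ i, g (x i) with hA
  set B : (Fin N → α) → ℝ := fun x => ∑ i, h (x i) with hBdef
  have bA : IsBdd A := bg.sum_eval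
  have bB : IsBdd B := bh.sum_eval
  have pt (x : Fin N → α) : (∑ i, h (x i) * F (x i)) / B x = c + A x / B x := by
    have : ∑ i, h (x i) * F (x i) = A x + c * B x := by
      simp only [hA, hg, hBdef, Finset.mul_sum, ← Finset.sum_add_distrib, sub_add_cancel]
    rw [this, add_div, mul_div_cancel_right₀ _ (hB0 x).ne', add_comm]
  set R : (Fin N → α) → ℝ := fun x => A x * (N * μ - B x) / (B x * (N * μ)) with hR
  have bBi : IsBdd fun x => (B x)⁻¹ := by
    refine .of_mem_Icc (a := 0) (b := (N * lo)⁻¹) fun x => ⟨?_, ?_⟩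
    · exact inv_nonneg.2 (hB0 x).le
    · exact inv_anti₀ (by positivity) (hB x)
  -- Replacing the random denominator by its mean leaves a term of mean zero; only the product of
  -- two fluctuations in `R` contributes to the bias.
  have split (x : Fin N → α) : A x / B x = A x * (N * μ)⁻¹ + R x := by
    simp only [hR]
    have := (hB0 x).ne'
    change B x ≠ 0 at this
    field_simp
    ring
  set D : ℝ := ((N * lo) * (N * μ))⁻¹ with hD
  have hD0 : 0 < D := by positivity
  -- Young's inequality; the weight `1 / 4` makes both terms contribute at most `N * hi * μ / 4` in
  -- mean.
  have Rle (x : Fin N → α) : |R x| ≤ D * ((A x + 0) ^ 2 + (B x + -(N * μ)) ^ 2 * (1 / 4)) := by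
    simp only [hR]
    rw [abs_div, abs_of_pos (mul_pos (hB0 x) (by positivity : 0 < N * μ)), div_eq_inv_mul]
    refine mul_le_mul ?_ ?_ (abs_nonneg _) hD0.le
    · exact inv_anti₀ (by positivity) (mul_le_mul_of_nonneg_right (hB x) (by positivity))
    · rw [abs_le]
      constructor <;> nlinarith [sq_nonneg (A x + (N * μ - B x) / 2),
        sq_nonneg (A x - (N * μ - B x) / 2)]
  have bQ : IsBdd fun x => (A x + 0) ^ 2 := (bA.add (.const _)).sq
  have bQ' : IsBdd fun x => (B x + -(N * μ)) ^ 2 := (bB.add (.const _)).sq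
  have bQ2 := (IsBdd.const (α := Fin N → α) D).mul (bQ.add (bQ'.mul (.const (1 / 4))))
  have bR : IsBdd R := by
    obtain ⟨C, hC⟩ := bQ2
    exact ⟨C, fun x => (Rle x).trans ((le_abs_self _).trans (hC x))⟩
  have key : expect (indep p) (fun x => D * ((A x + 0) ^ 2 + (B x + -(N * μ)) ^ 2 * (1 / 4)))
      ≤ hi / lo / (2 * N) := by
    rw [expect_mul_left, expect_add _ bQ (bQ'.mul (.const _)), expect_mul_right]
    calc _ ≤ D * (N * (hi * μ) / 2) := by
          refine mul_le_mul_of_nonneg_left ?_ hD0.le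
          have l1 : expect (indep p) (fun x => (A x + 0) ^ 2) ≤ N * (hi * μ / 4) := by
            have := mul_le_mul_of_nonneg_left mg2 hN.le
            linarith
          have l2 : expect (indep p) (fun x => (B x + -(N * μ)) ^ 2) ≤ N * (hi * μ) := by
            have := mul_le_mul_of_nonneg_left mh2 hN.le
            linarith
          linarith
      _ = _ := by
          rw [hD]
          field_simp
  have total : expect (indep p) (fun x => (∑ i, h (x i) * F (x i)) / B x) - c
      = expect (indep p) R := by
    simp only [pt, split]
    rw [expect_add _ (.const _) ((bA.mul (.const _)).add bR), expect_const,
      expect_add _ (bA.mul (.const _)) bR, expect_mul_right, eg]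
    ring
  rw [total]
  refine le_trans (abs_le.2 ⟨?_, ?_⟩) key
  · have := expect_mono (indep p) ((IsBdd.const (-1)).mul bQ2) bR
      fun x => by linarith [neg_le_of_abs_le (Rle x)]
    rw [expect_mul_left] at this
    linarith
  · exact expect_mono _ bR bQ2 fun x => (le_abs_self _).trans (Rle x)

end Samples

theorem expect_pos {α : Type u} (μ : PMF α) {f : α → ℝ} (hf : IsBdd f) (h : ∀ a, 0 < f a) :
    0 < expect μ f := by
  obtain ⟨a, ha⟩ := μ.support_nonempty
  refine (summable_expect μ hf).tsum_pos
    (fun b => mul_nonneg ENNReal.toReal_nonneg (h b).le) a (mul_pos ?_ (h a))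
  exact ENNReal.toReal_pos ((μ.mem_support_iff a).1 ha) (μ.apply_ne_top a)

/-! ## The base model -/

section Rollout

variable {S : ℕ → Type u} (π : ∀ t, Prefix S t → PMF (S (t + 1)))

theorem rollout_self {t : ℕ} (x : Prefix S t) : rollout π le_rfl x = PMF.pure x :=
  Nat.leRecOn_self _

theorem rollout_succ {t T : ℕ} (h : t ≤ T) (h' : t ≤ T + 1) (x : Prefix S t) :
    rollout π h' x = (rollout π h x).bind (naiveKernel π T) :=
  Nat.leRecOn_succ (C := fun k => PMF (Prefix S k)) h _

/-- `rollout` grows at the terminal end; associativity of `bind` peels off its first step instead,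
as the backward recursion of the semigroup requires. -/
theorem rollout_eq_naiveKernel_bind {t T : ℕ} (h : t + 1 ≤ T) (x : Prefix S t) :
    rollout π (Nat.le_of_succ_le h) x = (naiveKernel π t x).bind (rollout π h) := by
  induction T, h using Nat.le_induction with
  | base =>
    rw [rollout_succ π le_rfl, rollout_self, PMF.pure_bind]
    have : rollout π (le_refl (t + 1)) = PMF.pure := funext (rollout_self π)
    rw [this, PMF.bind_pure]
  | succ T h ih =>
    rw [rollout_succ π (Nat.le_of_succ_le h), ih, PMF.bind_bind]
    congr 1
    funext y
    rw [rollout_succ π h]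

theorem isBdd_prefix_zero (f : Prefix S 0 → ℝ) : IsBdd f := ⟨|f Prefix.nil|, fun _ => le_rfl⟩

end Rollout

/-! ## The Feynman–Kac semigroup -/

section Semigroup

variable {S : ℕ → Type u}

/-- The standing assumptions on the reward model. -/
structure Regular (π : ∀ t, Prefix S t → PMF (S (t + 1))) (V : ∀ t, Prefix S t → ℝ≥0) (T : ℕ)
    (L ε : ℝ) : Prop where
  L_pos : 0 < L
  V_pos : ∀ t ≤ T, ∀ x : Prefix S t, 0 < V t x
  ratio : RatioBound V T L
  bellman : GlobalBellmanBound π V T ε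

/-- The reward of the prefix without its last state (the reward of the empty prefix at time `0`). -/
def prevValue (V : ∀ t, Prefix S t → ℝ≥0) : ∀ t, Prefix S t → ℝ≥0
  | 0, x => V 0 x
  | t + 1, x => V t x.init

/-- The unnormalized Feynman–Kac semigroup from time `t` to the terminal time, applied to `f`. -/
noncomputable def semigroup (π : ∀ t, Prefix S t → PMF (S (t + 1))) (V : ∀ t, Prefix S t → ℝ≥0) {t T : ℕ}
    (h : t ≤ T) (f : Prefix S T → ℝ) (x : Prefix S t) : ℝ :=
  expect (rollout π h x) (fun y => (V T y : ℝ) * f y) / prevValue V t x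

/-- The integral of `f` against the image of the law `η` under the normalized Feynman–Kac semigroup
from time `t` to the terminal time. -/
noncomputable def terminalMean (π : ∀ t, Prefix S t → PMF (S (t + 1))) (V : ∀ t, Prefix S t → ℝ≥0) {t T : ℕ}
    (h : t ≤ T) (f : Prefix S T → ℝ) (η : PMF (Prefix S t)) : ℝ :=
  expect η (semigroup π V h f) / expect η (semigroup π V h fun _ => 1)

variable {π : ∀ t, Prefix S t → PMF (S (t + 1))} {V : ∀ t, Prefix S t → ℝ≥0} {t T : ℕ} {L ε : ℝ}

namespace Regular

theorem prevValue_pos (H : Regular π V T L ε) : ∀ {t : ℕ}, t ≤ T → ∀ x : Prefix S t,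
    0 < prevValue V t x
  | 0, h, x => H.V_pos 0 h x
  | _ + 1, h, x => H.V_pos _ (Nat.le_of_succ_le h) x.init

theorem potential_eq (H : Regular π V T L ε) : ∀ {t : ℕ}, t ≤ T → ∀ x : Prefix S t,
    (potential V t x : ℝ) = V t x / prevValue V t x
  | 0, h, x => by
    have : (V 0 x : ℝ) ≠ 0 := by exact_mod_cast (H.V_pos 0 h x).ne'
    simp [potential, prevValue, this]
  | _ + 1, _, x => NNReal.coe_div _ _

theorem potential_pos (H : Regular π V T L ε) (h : t ≤ T) (x : Prefix S t) :
    0 < potential V t x := by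
  rw [← NNReal.coe_pos, H.potential_eq h]
  exact div_pos (H.V_pos t h x) (H.prevValue_pos h x)

theorem isBdd_potential (H : Regular π V T L ε) : ∀ {t : ℕ}, t ≤ T →
    IsBdd fun x : Prefix S t => (potential V t x : ℝ)
  | 0, _ => .const _
  | t + 1, h => .of_mem_Icc fun x => ⟨NNReal.coe_nonneg _, by
      rw [H.potential_eq h]
      exact (le_max_right _ _).trans (H.ratio t h x)⟩

/-- There is only one empty prefix, and each further state multiplies the reward by a bounded
factor. -/
theorem isBdd_V (H : Regular π V T L ε) : ∀ {t : ℕ}, t ≤ T →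
    IsBdd fun x : Prefix S t => (V t x : ℝ)
  | 0, _ => isBdd_prefix_zero _
  | t + 1, h => by
    have e : (fun x : Prefix S (t + 1) => (V (t + 1) x : ℝ))
        = fun x => (potential V (t + 1) x : ℝ) * V t x.init := by
      funext x
      have : (V t x.init : ℝ) ≠ 0 := by exact_mod_cast (H.prevValue_pos h x).ne'
      rw [H.potential_eq h]
      exact (div_mul_cancel₀ _ this).symm
    rw [e]
    exact (H.isBdd_potential h).mul ((H.isBdd_V (Nat.le_of_succ_le h)).comp Prefix.init)

theorem expect_rollout_pos (H : Regular π V T L ε) (h : t ≤ T) (x : Prefix S t) :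
    0 < expect (rollout π h x) fun y => (V T y : ℝ) :=
  expect_pos _ (H.isBdd_V le_rfl) fun y => H.V_pos T le_rfl y

theorem semigroup_one_pos (H : Regular π V T L ε) (h : t ≤ T) (x : Prefix S t) :
    0 < semigroup π V h (fun _ => 1) x := by
  simp only [semigroup, mul_one]
  exact div_pos (H.expect_rollout_pos h x) (H.prevValue_pos h x)

/-- The sign of `1 + ε` is not assumed: it follows because `1 + ε` dominates a positive ratio. -/
theorem one_add_pos (H : Regular π V T L ε) (h : t < T) (x : Prefix S (t + 1)) : 0 < 1 + ε :=
  (div_pos (NNReal.coe_pos.2 (H.V_pos _ h x)) (H.expect_rollout_pos h x)).trans_le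
    ((le_max_left _ _).trans (H.bellman (t + 1) (by omega) h x))

/-- Factor through the current reward: one quotient is controlled by the ratio bound, the other by
the Bellman bound. -/
theorem semigroup_one_mem_Icc (H : Regular π V T L ε) (h : t < T) (x : Prefix S (t + 1)) :
    (L * (1 + ε))⁻¹ ≤ semigroup π V (Nat.succ_le_of_lt h) (fun _ => 1) x ∧
      semigroup π V (Nat.succ_le_of_lt h) (fun _ => 1) x ≤ L * (1 + ε) := by
  have hε := H.one_add_pos h x
  have hB := max_le_iff.1 (H.bellman (t + 1) (by omega) h x)
  have hR := max_le_iff.1 (H.ratio t h x)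
  have hE := H.expect_rollout_pos h x
  have hV : (0 : ℝ) < V (t + 1) x := H.V_pos _ h x
  have hP : (0 : ℝ) < V t x.init := H.V_pos t h.le x.init
  simp only [semigroup, mul_one]
  change _ ≤ _ / (V t x.init : ℝ) ∧ _ / (V t x.init : ℝ) ≤ _
  set E := expect (rollout π h x) fun y => (V T y : ℝ)
  constructor
  · rw [inv_le_comm₀ (mul_pos H.L_pos hε) (div_pos hE hP), inv_div]
    calc (V t x.init : ℝ) / E = V t x.init / V (t + 1) x * (V (t + 1) x / E) := by field_simp
      _ ≤ _ := mul_le_mul hR.1 hB.1 (by positivity) H.L_pos.le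
  · calc E / V t x.init = V (t + 1) x / V t x.init * (E / V (t + 1) x) := by field_simp
      _ ≤ _ := mul_le_mul hR.2 hB.2 (by positivity) H.L_pos.le

theorem isBdd_semigroup_one (H : Regular π V T L ε) : ∀ {t : ℕ} (h : t ≤ T),
    IsBdd (semigroup π V h fun _ => 1)
  | 0, _ => isBdd_prefix_zero _
  | _ + 1, h => .of_mem_Icc (H.semigroup_one_mem_Icc h)

variable {f : Prefix S T → ℝ}

theorem semigroup_mem_Icc (H : Regular π V T L ε) (hf : ∀ y, 0 ≤ f y ∧ f y ≤ 1) (h : t ≤ T)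
    (x : Prefix S t) :
    0 ≤ semigroup π V h f x ∧ semigroup π V h f x ≤ semigroup π V h (fun _ => 1) x := by
  have bV := H.isBdd_V le_rfl
  have hP : (0 : ℝ) < prevValue V t x := H.prevValue_pos h x
  have b : IsBdd f := .of_mem_Icc hf
  constructor
  · refine div_nonneg ?_ hP.le
    have := expect_mono (rollout π h x) (.const 0) (bV.mul b) fun y =>
      mul_nonneg (NNReal.coe_nonneg _) (hf y).1
    rwa [expect_const] at this
  · exact div_le_div_of_nonneg_right (expect_mono _ (bV.mul b) (bV.mul (.const 1)) fun y =>
      mul_le_mul_of_nonneg_left (hf y).2 (NNReal.coe_nonneg _)) hP.le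

theorem isBdd_semigroup (H : Regular π V T L ε) (hf : ∀ y, 0 ≤ f y ∧ f y ≤ 1) (h : t ≤ T) :
    IsBdd (semigroup π V h f) := by
  obtain ⟨C, hC⟩ := H.isBdd_semigroup_one h
  refine ⟨C, fun x => ?_⟩
  have := H.semigroup_mem_Icc hf h x
  rw [abs_of_nonneg this.1]
  exact this.2.trans ((le_abs_self _).trans (hC x))

theorem terminalMean_mem_Icc (H : Regular π V T L ε) (hf : ∀ y, 0 ≤ f y ∧ f y ≤ 1) (h : t ≤ T)
    (η : PMF (Prefix S t)) : 0 ≤ terminalMean π V h f η ∧ terminalMean π V h f η ≤ 1 := by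
  have b1 := H.isBdd_semigroup_one h
  have b := H.isBdd_semigroup hf h
  have p := expect_pos η b1 (H.semigroup_one_pos h)
  constructor
  · refine div_nonneg ?_ p.le
    have := expect_mono η (.const 0) b fun x => (H.semigroup_mem_Icc hf h x).1
    rwa [expect_const] at this
  · exact (div_le_one p).2 (expect_mono η b b1 fun x => (H.semigroup_mem_Icc hf h x).2)

theorem expect_fkMap_semigroup (H : Regular π V T L ε) (hf : ∀ y, 0 ≤ f y ∧ f y ≤ 1)
    (h : t + 1 ≤ T) (η : PMF (Prefix S t)) :
    expect (fkMap π V t η) (semigroup π V h f)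
      = expect η (semigroup π V (Nat.le_of_succ_le h) f)
        / expect η fun x => (potential V t x : ℝ) := by
  have h' := Nat.le_of_succ_le h
  have b := H.isBdd_semigroup hf h
  have bVf : IsBdd fun y => (V T y : ℝ) * f y := (H.isBdd_V le_rfl).mul (.of_mem_Icc hf)
  rw [fkMap, expect_bind _ _ b, expect_reweight _ (H.potential_pos h') (H.isBdd_potential h')]
  congr 2
  funext x
  have hV : (V t x : ℝ) ≠ 0 := by exact_mod_cast (H.V_pos t h' x).ne'
  have e : expect (naiveKernel π t x) (semigroup π V h f)
      = expect (rollout π h' x) (fun y => (V T y : ℝ) * f y) / V t x := by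
    rw [rollout_eq_naiveKernel_bind π h, expect_bind _ _ bVf, naiveKernel, expect_map _ _ b,
      expect_map _ _ (bVf.expect _), div_eq_mul_inv, ← expect_mul_right]
    -- Appending a state to `x` makes `V t x` the previous value, a constant that leaves the
    -- expectation and later cancels the numerator of the potential.
    rfl
  rw [e, H.potential_eq h', semigroup]
  field_simp

/-- The normalizing constant of the reweighting appears in numerator and denominator alike and
cancels. -/
theorem terminalMean_fkMap (H : Regular π V T L ε) (hf : ∀ y, 0 ≤ f y ∧ f y ≤ 1)
    (h : t + 1 ≤ T) (η : PMF (Prefix S t)) :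
    terminalMean π V h f (fkMap π V t η) = terminalMean π V (Nat.le_of_succ_le h) f η := by
  have h' := Nat.le_of_succ_le h
  rw [terminalMean, H.expect_fkMap_semigroup hf, H.expect_fkMap_semigroup (by norm_num),
    div_div_div_cancel_right₀, terminalMean]
  exact (expect_pos η (H.isBdd_potential h') fun x => H.potential_pos h' x).ne'

theorem expect_fkTerminalMap (H : Regular π V T L ε) (η : PMF (Prefix S T))
    (f : Prefix S T → ℝ) :
    expect (fkTerminalMap V T η) f = terminalMean π V le_rfl f η := by
  rw [fkTerminalMap, expect_reweight _ (H.potential_pos le_rfl) (H.isBdd_potential le_rfl),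
    terminalMean]
  congr 2 <;> funext x <;> rw [H.potential_eq le_rfl, semigroup, rollout_self, expect_pure] <;> ring

theorem terminalMean_pure_nil (H : Regular π V T L ε) (f : Prefix S T → ℝ) :
    terminalMean π V (Nat.zero_le T) f (PMF.pure Prefix.nil) = expect (target π V T) f := by
  have : ((prevValue V 0 (Prefix.nil : Prefix S 0) : ℝ≥0) : ℝ) ≠ 0 := by
    exact_mod_cast (H.prevValue_pos (Nat.zero_le T) _).ne'
  rw [target, expect_reweight _ (H.V_pos T le_rfl) (H.isBdd_V le_rfl), terminalMean, expect_pure,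
    expect_pure, semigroup, semigroup, div_div_div_cancel_right₀ this]
  simp only [mul_one]

theorem terminalMean_fkFlow (H : Regular π V T L ε) (hf : ∀ y, 0 ≤ f y ∧ f y ≤ 1) :
    ∀ {t : ℕ} (h : t ≤ T), terminalMean π V h f (fkFlow π V t) = expect (target π V T) f
  | 0, _ => H.terminalMean_pure_nil f
  | _ + 1, h => (H.terminalMean_fkMap hf h _).trans (H.terminalMean_fkFlow hf _)

theorem fkTerminal_eq_target (H : Regular π V T L ε) : fkTerminal π V T = target π V T :=
  pmf_ext_expect fun f hf => by
    rw [fkTerminal, H.expect_fkTerminalMap, H.terminalMean_fkFlow hf]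

/-! ## The bias of the particle approximation -/

variable {K : ∀ t, PMF (Prefix S t) → Prefix S t → PMF (Prefix S (t + 1))}
  {K' : PMF (Prefix S T) → Prefix S T → PMF (Prefix S T)} {N : ℕ} [NeZero N]

theorem abs_expect_particleLaw_succ_sub_le (H : Regular π V T L ε) (hK : IsMcKean π V T K K')
    (hf : ∀ y, 0 ≤ f y ∧ f y ≤ 1) (h : t + 1 ≤ T) :
    |expect (particleLaw K N (t + 1)) (fun x => terminalMean π V h f (empirical x))
        - expect (particleLaw K N t)
          (fun x => terminalMean π V (Nat.le_of_succ_le h) f (empirical x))|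
      ≤ (L * (1 + ε)) ^ 2 / (2 * N) := by
  have b (k : ℕ) (hk : k ≤ T) :
      IsBdd fun x : Fin N → Prefix S k => terminalMean π V hk f (empirical x) :=
    .of_mem_Icc fun x => H.terminalMean_mem_Icc hf hk _
  rw [particleLaw, expect_bind _ _ (b _ h), ← expect_sub _ ((b _ h).expect _) (b _ _)]
  refine abs_expect_le _ fun x => ?_
  rw [← H.terminalMean_fkMap hf h]
  -- Some prefix of length `t + 1` is needed to know that `1 + ε` is positive.
  obtain ⟨y, -⟩ := (fkMap π V t (empirical x)).support_nonempty
  have hM : 0 < L * (1 + ε) := mul_pos H.L_pos (H.one_add_pos h y)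
  have hN : (N : ℝ) ≠ 0 := Nat.cast_ne_zero.2 (NeZero.ne N)
  set h1 := semigroup π V h fun _ => 1 with hh1
  have p1 : ∀ z, 0 < h1 z := H.semigroup_one_pos h
  set F : Prefix S (t + 1) → ℝ := fun z => semigroup π V h f z / h1 z
  have hF (z) : h1 z * F z = semigroup π V h f z := mul_div_cancel₀ _ (p1 z).ne'
  have key := abs_expect_indep_ratio_sub_le (fun i => K t (empirical x) (x i))
    (fkMap π V t (empirical x)) (fun g hg => by
      -- The McKean property fixes only the average of the particles' laws, and this is all that the
      -- bias bound uses.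
      rw [← hK.1 t h, expect_bind _ _ hg, expect_empirical _ (hg.expect _)]
      field_simp) (inv_pos.2 hM) (H.semigroup_one_mem_Icc h) (F := F) fun z =>
        ⟨div_nonneg (H.semigroup_mem_Icc hf h z).1 (p1 z).le,
          (div_le_one (p1 z)).2 (H.semigroup_mem_Icc hf h z).2⟩
  rw [← hh1] at key
  simp only [hF] at key
  have e (z : Fin N → Prefix S (t + 1)) : terminalMean π V h f (empirical z)
      = (∑ i, semigroup π V h f (z i)) / ∑ i, h1 (z i) := by
    rw [terminalMean, expect_empirical _ (H.isBdd_semigroup hf h),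
      expect_empirical _ (H.isBdd_semigroup_one h), div_div_div_cancel_right₀ hN]
  simp only [e]
  refine key.trans_eq ?_
  rw [div_inv_eq_mul, pow_two]

theorem abs_expect_particleLaw_sub_le (H : Regular π V T L ε) (hK : IsMcKean π V T K K')
    (hf : ∀ y, 0 ≤ f y ∧ f y ≤ 1) : ∀ {t : ℕ} (h : t ≤ T),
    |expect (particleLaw K N t) (fun x => terminalMean π V h f (empirical x))
        - expect (target π V T) f| ≤ t * ((L * (1 + ε)) ^ 2 / (2 * N))
  | 0, h => by
    have : empirical (fun _ : Fin N => (Prefix.nil : Prefix S 0)) = PMF.pure Prefix.nil :=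
      PMF.map_const _ _
    rw [particleLaw, expect_pure, this, H.terminalMean_pure_nil]
    simp
  | t + 1, h => by
    have h1 := H.abs_expect_particleLaw_succ_sub_le (N := N) hK hf h
    have h2 := H.abs_expect_particleLaw_sub_le hK hf (Nat.le_of_succ_le h)
    refine (abs_sub_le _ _ _).trans ((add_le_add h1 h2).trans_eq ?_)
    push_cast
    ring

theorem abs_expect_outputLaw_sub_le (H : Regular π V T L ε) (hK : IsMcKean π V T K K')
    (hf : ∀ y, 0 ≤ f y ∧ f y ≤ 1) :
    |expect (outputLaw K K' N) f - expect (target π V T) f|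
      ≤ T * ((L * (1 + ε)) ^ 2 / (2 * N)) := by
  have b : IsBdd f := .of_mem_Icc hf
  have hN : (N : ℝ) ≠ 0 := Nat.cast_ne_zero.2 (NeZero.ne N)
  have e : expect (outputLaw K K' N) f = expect (particleLaw K N T)
      fun x => terminalMean π V le_rfl f (empirical x) := by
    rw [outputLaw, expect_bind _ _ b, expect_bind _ _ (b.expect _)]
    congr 1
    funext x
    simp only [expect_empirical _ b, div_eq_mul_inv]
    rw [expect_mul_right, expect_indep_sum _ b, ← H.expect_fkTerminalMap, ← hK.2,
      expect_bind _ _ b, expect_empirical _ (b.expect _), div_eq_mul_inv]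
  rw [e]
  exact H.abs_expect_particleLaw_sub_le hK hf le_rfl

/-- The interval from `M⁻¹` to `M` contains a value of the semigroup, so it is nonempty. -/
theorem one_le_mul_one_add (H : Regular π V T L ε) (hT : 0 < T) : 1 ≤ L * (1 + ε) := by
  obtain ⟨x, -⟩ := (rollout π (Nat.zero_le 1) Prefix.nil).support_nonempty
  have hb := H.semigroup_one_mem_Icc hT x
  have hM : 0 < L * (1 + ε) := mul_pos H.L_pos (H.one_add_pos hT x)
  by_contra! hlt
  linarith [hb.1.trans hb.2, one_lt_inv_iff₀.2 ⟨hM, hlt⟩]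

theorem tvDist_outputLaw_le (H : Regular π V T L ε) (hT : 0 < T) (hK : IsMcKean π V T K K')
    {δ : ℝ} (hδ : 0 < δ) (hN : L ^ 6 * T * (1 + ε) ^ 6 / (2 * δ) ≤ N) :
    tvDist (outputLaw K K' N) (target π V T) ≤ δ := by
  refine tvDist_le hδ.le fun f hf => (H.abs_expect_outputLaw_sub_le hK hf).trans ?_
  have hN0 : (0 : ℝ) < N := Nat.cast_pos.2 (Nat.pos_of_ne_zero (NeZero.ne N))
  have hpow : (L * (1 + ε)) ^ 2 ≤ (L * (1 + ε)) ^ 6 :=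
    pow_le_pow_right₀ (H.one_le_mul_one_add hT) (by norm_num)
  rw [div_le_iff₀ (by positivity)] at hN
  rw [← mul_div_assoc, div_le_iff₀ (by positivity)]
  have : (T : ℝ) * (L * (1 + ε)) ^ 2 ≤ T * (L * (1 + ε)) ^ 6 := by gcongr
  rw [mul_pow _ _ 6] at this
  linarith

end Regular

end Semigroup

/-! ## Randomized computations: law of the result and running time -/

namespace Timed

variable {α : Type u} {β : Type v}

theorem output_ret (a : α) : (ret a).output = PMF.pure a := PMF.pure_map _ _

theorem output_calc (k : ℕ) (a : α) : (Timed.calc k a).output = PMF.pure a := PMF.pure_map _ _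

theorem output_draw (p : PMF α) : (draw p).output = p := by
  rw [output, draw, PMF.map_comp]
  exact PMF.map_id p

theorem output_bind (x : Timed α) (f : α → Timed β) :
    (x.bind f).output = x.output.bind fun a => (f a).output := by
  have (p : PMF (α × ℕ)) (g : α → PMF (β × ℕ)) :
      (p.bind fun q => (g q.1).map fun r : β × ℕ => (r.1, q.2 + r.2)).map Prod.fst
        = (p.map Prod.fst).bind fun a => (g a).map Prod.fst := by
    simp only [PMF.map_bind, PMF.bind_map, PMF.map_comp]
    rfl
  exact this x f

theorem output_forEach : ∀ {N : ℕ} (c : Fin N → Timed α),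
    (forEach c).output = indep fun i => (c i).output
  | 0, _ => output_ret _
  | N + 1, c => by
    rw [forEach, output_bind, indep_succ]
    congr 1
    funext a
    rw [output_bind, output_forEach, ← PMF.bind_pure_comp]
    congr 1
    funext x
    exact output_ret _

theorem runsWithin_ret (a : α) : (ret a).RunsWithin 0 := fun p hp => by
  rw [ret, PMF.support_pure, Set.mem_singleton_iff] at hp
  simp [hp]

theorem runsWithin_calc (k : ℕ) (a : α) : (Timed.calc k a).RunsWithin k := fun p hp => by
  rw [Timed.calc, PMF.support_pure, Set.mem_singleton_iff] at hp
  simp [hp]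

theorem runsWithin_draw (q : PMF α) : (draw q).RunsWithin 1 := fun p hp => by
  rw [draw, PMF.mem_support_map_iff] at hp
  obtain ⟨a, -, rfl⟩ := hp
  simp

theorem RunsWithin.mono {x : Timed α} {A B : ℝ} (hx : x.RunsWithin A) (h : A ≤ B) :
    x.RunsWithin B := fun p hp => (hx p hp).trans h

theorem RunsWithin.bind {x : Timed α} {f : α → Timed β} {A B : ℝ} (hx : x.RunsWithin A)
    (hf : ∀ a, (f a).RunsWithin B) : (x.bind f).RunsWithin (A + B) := fun p hp => by
  obtain ⟨q, hq, hp⟩ := (PMF.mem_support_bind_iff (p := x) _ _).1 hp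
  obtain ⟨r, hr, rfl⟩ := (PMF.mem_support_map_iff _ _ _).1 hp
  push_cast
  exact add_le_add (hx q hq) (hf _ r hr)

theorem runsWithin_forEach {B : ℝ} : ∀ {N : ℕ} {c : Fin N → Timed α},
    (∀ i, (c i).RunsWithin B) → (forEach c).RunsWithin (N * B)
  | 0, _, _ => (runsWithin_ret _).mono (by simp)
  | N + 1, c, h => by
    rw [forEach]
    refine ((h 0).bind fun a => (runsWithin_forEach fun i => h i.succ).bind fun x =>
      runsWithin_ret _).mono (le_of_eq ?_)
    push_cast
    ring

end Timed

/-! ## The naive-proposal SMC algorithm -/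

section Algorithm

variable {S : ℕ → Type u}

theorem output_weightStep (V : ∀ t, Prefix S t → ℝ≥0) : ∀ (t : ℕ) (x : Prefix S t),
    (weightStep V t x).output = PMF.pure (potential V t x)
  | 0, _ => Timed.output_ret _
  | t + 1, x => by
    simp only [weightStep, Timed.output_bind, Timed.output_calc, PMF.pure_bind]
    rfl

theorem runsWithin_weightStep (V : ∀ t, Prefix S t → ℝ≥0) : ∀ (t : ℕ) (x : Prefix S t),
    (weightStep V t x).RunsWithin 3
  | 0, _ => (Timed.runsWithin_ret _).mono (by norm_num)
  | t + 1, x => ((Timed.runsWithin_calc _ _).bind fun _ => (Timed.runsWithin_calc _ _).bind fun _ =>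
      Timed.runsWithin_calc _ _).mono (by norm_num)

theorem output_resample {N : ℕ} [NeZero N] (w : Fin N → ℝ≥0) :
    (resample w).output = indep fun _ => categorical w := by
  simp only [resample, Timed.output_bind, Timed.output_calc, PMF.pure_bind, Timed.output_forEach,
    Timed.output_draw]

theorem runsWithin_resample {N : ℕ} [NeZero N] (w : Fin N → ℝ≥0) :
    (resample w).RunsWithin (4 * N) :=
  ((Timed.runsWithin_calc _ _).bind fun _ => Timed.runsWithin_forEach fun _ =>
    Timed.runsWithin_draw _).mono (le_of_eq (by push_cast; ring))

theorem output_extend (π : ∀ t, Prefix S t → PMF (S (t + 1))) (t : ℕ) (x : Prefix S t) :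
    (extend π t x).output = naiveKernel π t x := by
  simp only [extend, Timed.output_bind, Timed.output_draw, Timed.output_calc]
  exact PMF.bind_pure_comp _ _

theorem runsWithin_extend (π : ∀ t, Prefix S t → PMF (S (t + 1))) (t : ℕ) (x : Prefix S t) :
    (extend π t x).RunsWithin 2 :=
  ((Timed.runsWithin_draw _).bind fun _ => Timed.runsWithin_calc _ _).mono (by norm_num)

variable {N : ℕ} [NeZero N]

/-- Compared through expectations, so that coinciding particles need no separate treatment. Positive
weights exclude the fallback laws on both sides. -/
theorem map_categorical {α : Type u} {w : α → ℝ≥0} (hw : ∀ a, 0 < w a)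
    (hb : IsBdd fun a => (w a : ℝ)) (x : Fin N → α) :
    (categorical fun i => w (x i)).map x = reweight (empirical x) w :=
  pmf_ext_expect fun f hf => by
    have b : IsBdd f := .of_mem_Icc hf
    rw [expect_map _ _ b, expect_categorical fun i => hw (x i), expect_reweight _ hw hb,
      expect_empirical _ (hb.mul b), expect_empirical _ hb,
      div_div_div_cancel_right₀ (Nat.cast_ne_zero.2 (NeZero.ne N))]

variable {π : ∀ t, Prefix S t → PMF (S (t + 1))} {V : ∀ t, Prefix S t → ℝ≥0} {t T : ℕ} {L ε : ℝ}

namespace Regular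

theorem map_categorical_potential (H : Regular π V T L ε) (h : t ≤ T) (x : Fin N → Prefix S t) :
    (categorical fun i => potential V t (x i)).map x = reweight (empirical x) (potential V t) :=
  map_categorical (H.potential_pos h) (H.isBdd_potential h) x

theorem output_smcRound (H : Regular π V T L ε) : ∀ {t : ℕ}, t ≤ T → ∀ x : Fin N → Prefix S t,
    (smcRound π V t x).output = indep fun _ => fkMap π V t (empirical x)
  | 0, _, x => by
    rw [smcRound, Timed.output_forEach]
    congr 1
    funext i
    -- All prefixes of length `0` are equal, so the kernel is constant and the reweighting at time
    -- `0` has no effect.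
    have : naiveKernel π 0 = fun _ => naiveKernel π 0 (x i) := funext fun _ => rfl
    rw [output_extend, fkMap, this, PMF.bind_const]
  | t + 1, h, x => by
    simp only [smcRound, Timed.output_bind, Timed.output_forEach, output_weightStep, indep_pure,
      PMF.pure_bind, output_resample, output_extend]
    rw [indep_bind_indep (fun _ => _) fun _ a => naiveKernel π (t + 1) (x a)]
    congr 1
    funext i
    rw [fkMap, ← H.map_categorical_potential h, PMF.bind_map]
    rfl

theorem output_smcRounds (H : Regular π V T L ε) : ∀ {t : ℕ}, t ≤ T →
    (smcRounds π V N t).output = particleLaw (fun t η _ => fkMap π V t η) N t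
  | 0, _ => Timed.output_ret _
  | t + 1, h => by
    rw [smcRounds, Timed.output_bind, H.output_smcRounds (Nat.le_of_succ_le h), particleLaw]
    congr 1
    funext x
    exact H.output_smcRound (Nat.le_of_succ_le h) x

theorem output_naiveSMC (H : Regular π V T L ε) :
    (naiveSMC π V T N).output
      = outputLaw (fun t η _ => fkMap π V t η) (fun η _ => fkTerminalMap V T η) N := by
  simp only [naiveSMC, Timed.output_bind, Timed.output_forEach, output_weightStep, indep_pure,
    PMF.pure_bind, output_resample, Timed.output_draw, Timed.output_calc, Timed.output_ret,
    H.output_smcRounds le_rfl]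
  rw [outputLaw, PMF.bind_bind]
  congr 1
  funext x
  have e : (indep fun _ : Fin N => fkTerminalMap V T (empirical x))
      = (indep fun _ => categorical fun i => potential V T (x i)).bind
        fun A => PMF.pure fun i => x (A i) := by
    rw [fkTerminalMap, ← H.map_categorical_potential le_rfl, ← PMF.bind_pure_comp,
      ← indep_bind_indep]
    simp only [Function.comp_apply, indep_pure]
  rw [e, PMF.bind_bind]
  simp only [PMF.pure_bind]
  rfl

end Regular

theorem isMcKean_naive (π : ∀ t, Prefix S t → PMF (S (t + 1))) (V : ∀ t, Prefix S t → ℝ≥0)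
    (T : ℕ) :
    IsMcKean π V T (fun t η _ => fkMap π V t η) (fun η _ => fkTerminalMap V T η) :=
  ⟨fun _ _ _ => PMF.bind_const _ _, fun _ => PMF.bind_const _ _⟩

/-- Per particle: three operations for weighting, four for resampling, two for extending. -/
theorem runsWithin_smcRound (π : ∀ t, Prefix S t → PMF (S (t + 1))) (V : ∀ t, Prefix S t → ℝ≥0) :
    ∀ (t : ℕ) (x : Fin N → Prefix S t), (smcRound π V t x).RunsWithin (9 * N)
  | 0, x => by
    rw [smcRound]
    exact (Timed.runsWithin_forEach fun _ => runsWithin_extend _ _ _).mono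
      (by linarith [N.cast_nonneg (α := ℝ)])
  | t + 1, x => by
    rw [smcRound]
    exact ((Timed.runsWithin_forEach fun _ => runsWithin_weightStep _ _ _).bind fun w =>
      (runsWithin_resample w).bind fun _ => Timed.runsWithin_forEach fun _ =>
        runsWithin_extend _ _ _).mono (le_of_eq (by ring))

theorem runsWithin_smcRounds (π : ∀ t, Prefix S t → PMF (S (t + 1)))
    (V : ∀ t, Prefix S t → ℝ≥0) :
    ∀ t : ℕ, (smcRounds π V N t).RunsWithin (9 * N * t)
  | 0 => (Timed.runsWithin_ret _).mono (by simp)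
  | t + 1 => ((runsWithin_smcRounds π V t).bind (runsWithin_smcRound π V t)).mono
      (le_of_eq (by push_cast; ring))

theorem runsWithin_naiveSMC (π : ∀ t, Prefix S t → PMF (S (t + 1))) (V : ∀ t, Prefix S t → ℝ≥0)
    (T : ℕ) : (naiveSMC π V T N).RunsWithin (9 * N * (T + 1)) := by
  have hN : (1 : ℝ) ≤ N := by exact_mod_cast Nat.one_le_iff_ne_zero.2 (NeZero.ne N)
  refine ((runsWithin_smcRounds π V T).bind fun x =>
    (Timed.runsWithin_forEach fun _ => runsWithin_weightStep _ _ _).bind fun w =>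
      (runsWithin_resample w).bind fun A =>
        (Timed.runsWithin_forEach fun _ => Timed.runsWithin_calc _ _).bind fun y =>
          (Timed.runsWithin_draw _).bind fun _ => Timed.runsWithin_ret _).mono ?_
  push_cast
  -- The terminal stage costs `8 * N + 1`, which is at most `9 * N` as `N ≥ 1`.
  nlinarith

end Algorithm

end SMC

theorem mainTheorem11 :
    ∃ C : ℝ, 0 < C ∧
      ∀ (S : ℕ → Type*)
        (πref : S 0 → ∀ t, SMC.Prefix S t → PMF (S (t + 1)))
        (V : S 0 → ∀ t, SMC.Prefix S t → ℝ≥0)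
        (s₀ : S 0) (T : ℕ) (L ε δ : ℝ),
        2 ≤ T → 0 < δ → δ < 1 → 0 < L →
        (∀ t ≤ T, ∀ x : SMC.Prefix S t, 0 < V s₀ t x) →
        SMC.RatioBound (V s₀) T L →
        SMC.GlobalBellmanBound (πref s₀) (V s₀) T ε →
        -- the terminal law of the Feynman-Kac flow is the target
        SMC.fkTerminal (πref s₀) (V s₀) T = SMC.target (πref s₀) (V s₀) T ∧
        -- number of particles
        (∀ (N : ℕ) [NeZero N], L ^ 6 * T * (1 + ε) ^ 6 / (2 * δ) ≤ N →
          (∀ K K', SMC.IsMcKean (πref s₀) (V s₀) T K K' →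
            SMC.tvDist (SMC.outputLaw K K' N) (SMC.target (πref s₀) (V s₀) T) ≤ δ) ∧
          SMC.tvDist (SMC.naiveSMC (πref s₀) (V s₀) T N).output
            (SMC.target (πref s₀) (V s₀) T) ≤ δ) ∧
        -- total time
        ∃ (N : ℕ) (_ : NeZero N), L ^ 6 * T * (1 + ε) ^ 6 / (2 * δ) ≤ N ∧
          SMC.tvDist (SMC.naiveSMC (πref s₀) (V s₀) T N).output
            (SMC.target (πref s₀) (V s₀) T) ≤ δ ∧
          (SMC.naiveSMC (πref s₀) (V s₀) T N).RunsWithin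
            (C * (L ^ 6 * (1 + ε) ^ 6 * T ^ 2 / δ)) := by
  refine ⟨18, by norm_num, ?_⟩
  intro S πref V s₀ T L ε δ hT hδ hδ1 hL hV hratio hbell
  have H : SMC.Regular (πref s₀) (V s₀) T L ε := ⟨hL, hV, hratio, hbell⟩
  have hT0 : 0 < T := by omega
  have naive (N : ℕ) [NeZero N] (hN : L ^ 6 * T * (1 + ε) ^ 6 / (2 * δ) ≤ N) :
      SMC.tvDist (SMC.naiveSMC (πref s₀) (V s₀) T N).output
        (SMC.target (πref s₀) (V s₀) T) ≤ δ := by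
    rw [H.output_naiveSMC]
    exact H.tvDist_outputLaw_le hT0 (SMC.isMcKean_naive _ _ _) hδ hN
  refine ⟨H.fkTerminal_eq_target, fun N _ hN =>
    ⟨fun K K' hK => H.tvDist_outputLaw_le hT0 hK hδ hN, naive N hN⟩, ?_⟩
  set A : ℝ := L ^ 6 * T * (1 + ε) ^ 6 / (2 * δ) with hA
  have hTR : (2 : ℝ) ≤ T := by exact_mod_cast hT
  have hM : 1 ≤ L ^ 6 * (1 + ε) ^ 6 := by
    rw [← mul_pow]
    exact one_le_pow₀ (H.one_le_mul_one_add hT0)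
  -- Here `2 * δ ≤ 2 ≤ T`. With `A ≥ 1`, rounding up costs at most a factor two.
  have hA1 : 1 ≤ A := by
    rw [hA, le_div_iff₀ (by positivity)]
    nlinarith
  have hceil := Nat.ceil_lt_add_one (zero_le_one.trans hA1)
  have hne : NeZero ⌈A⌉₊ := ⟨(Nat.ceil_pos.2 (by linarith)).ne'⟩
  refine ⟨⌈A⌉₊, hne, Nat.le_ceil A, naive _ (Nat.le_ceil A), ?_⟩
  refine (SMC.runsWithin_naiveSMC _ _ T).mono ?_
  -- The constant 18 comes from `9 * N * (T + 1)` with `N ≤ 2 * A`, `T + 1 ≤ 2 * T` and the factor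
  -- `1 / 2` in `A`.
  have e : 18 * (L ^ 6 * (1 + ε) ^ 6 * (T : ℝ) ^ 2 / δ) = 9 * (2 * A) * (2 * T) := by
    rw [hA]
    field_simp
    ring
  rw [e]
  gcongr <;> linarith
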